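/- Let $\mathcal C$ be a nonempty class of finite groups closed under subgroups, homomorphic images and extensions. For a group $R$, the pro-$\mathcal C$ topology is the group topology in which the normal subgroups $N$ with $R/N\in\mathcal C$ form a base of neighbourhoods of $1$; $R$ is residually $\mathcal C$ if these $N$ intersect trivially; $R_{\hat{\mathcal C}}=\varprojlim R/N$ is its pro-$\mathcal C$ completion. Let $(\mathcal G,\Gamma)$ be a graph of groups over a connected (possibly infinite) graph $\Gamma$ with incidence maps $d_0,d_1$ and injective boundary homomorphisms $\partial_i:\mathcal G(e)\to\mathcal G(d_i(e))$, which is reduced: if an edge $e$ is not a loop, then $\partial_i(\mathcal G(e))\neq\mathcal G(d_i(e))$ for $i=0,1$. Let $T$ be a maximal subtree of $\Gamma$ and let $G=\pi_1(\mathcal G,\Gamma)$ be the fundamental group with respect to $T$, that is, the quotient of the path group $F(\mathcal G,\Gamma)=\langle \mathcal G(v)\,(v\in V(\Gamma)),\ t_e\,(e\in E(\Gamma))\mid \partial_0(x)=t_e\,\partial_1(x)\,t_e^{-1}\ (x\in\mathcal G(e))\rangle$ by the relations $t_e=1$ for $e\in E(T)$; edge groups are regarded as subgroups of $G$ through $\partial_0$.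 Assume that $G$ is residually $\mathcal C$. For a normal subgroup $U$ of $G$ that is open in the pro-$\mathcal C$ topology, the finite graph of finite groups $(\mathcal G_U,\Gamma_U)$ is defined as follows. Put $\mathcal G_U(m)=\mathcal G(m)U/U\le G/U$ for $m\in\Gamma$. Vertices $v,w$ of $\Gamma$ are identified if and only if $\mathcal G_U(v)=\mathcal G_U(w)$. Edges are identified by any equivalence relation $\approx$ with finitely many classes such that $e\approx e'$ implies that $d_i(e)$ and $d_i(e')$ are identified ($i=0,1$), that $\mathcal G_U(e)=\mathcal G_U(e')$, and that conjugation by $t_e$ and by $t_{e'}$ agree on $\mathcal G_U(e)$ in $G/U$ (for example, the relation for which $e\approx e'$ if and only if $d_i(e)$ and $d_i(e')$ are identified, $\mathcal G_U(e)=\mathcal G_U(e')$ and $t_eU=t_{e'}U$). Then $\Gamma_U$ is the quotient graph, the group of the class of $m$ is $\mathcal G_U(m)$, and the boundary maps are $\partial_i(gU)=\partial_i(g)U$, i.e. $\partial_0(x)=x$ and $\partial_1(x)=t_e^{-1}xt_e$ for $x\in\mathcal G_U(e)$. Suppose in addition that $G$ has a free open normal subgroup $\Phi$ with $G/\Phi\in\mathcal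 C$. Then for every open normal subgroup $U$ of $G$ with $U\le\Phi$ (in particular for all sufficiently small open normal $U\le\Phi$), every choice of $\approx$ as above, and every vertex $v$ of $\Gamma$ with image $v_U$ in $\Gamma_U$, the fundamental group $\pi_1(\mathcal G_U,\Gamma_U,v_U)$ (the subgroup of $F(\mathcal G_U,\Gamma_U)$ of elements given by closed paths at $v_U$) is residually $\mathcal C$. Moreover $(\mathcal G_U,\Gamma_U)$ is injective: for every base vertex, each vertex group and each edge group of $(\mathcal G_U,\Gamma_U)$ is mapped injectively into its pro-$\mathcal C$ fundamental group $\pi_1(\mathcal G_U,\Gamma_U,v_U)_{\hat{\mathcal C}}$ by the natural map (for a vertex group, $g\mapsto pgp^{-1}$ with $p$ a word along any path from the base vertex; for an edge group, the composite with $\partial_0$). -/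

import Mathlib

universe u

/-! ## Pseudovarieties and pro-`C` topologies -/

/-- A pseudovariety of finite groups closed under extensions: a nonempty class of finite groups
closed under subgroups, homomorphic images (so in particular isomorphisms) and extensions. -/
structure ExtClosedPseudovariety where
  Mem : ∀ (H : Type u) [Group H], Prop
  finite_of_mem : ∀ (H : Type u) [Group H], Mem H → Finite H
  exists_mem : ∃ (H : Type u) (_ : Group H), Mem H
  mem_subgroup : ∀ (H : Type u) [Group H] (K : Subgroup H), Mem H → Mem K
  mem_image : ∀ (H K : Type u) [Group H] [Group K] (f : H →* K),
    Function.Surjective f → Mem H → Mem K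
  mem_extension : ∀ (H : Type u) [Group H] (N : Subgroup H) [N.Normal],
    Mem N → Mem (H ⧸ N) → Mem H

namespace ExtClosedPseudovariety

variable (C : ExtClosedPseudovariety.{u}) (R : Type u) [Group R]

/-- The set of all normal subgroups `N` of `R` with `R/N ∈ C`. -/
structure NormalSub where
  toSubgroup : Subgroup R
  normal : toSubgroup.Normal
  mem : C.Mem (R ⧸ toSubgroup)

instance (N : C.NormalSub R) : N.toSubgroup.Normal := N.normal

variable {C} in
theorem mem_of_injective {H K : Type u} [Group H] [Group K] (f : H →* K)
    (hf : Function.Injective f) (hK : C.Mem K) : C.Mem H :=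
  C.mem_image f.range H (MonoidHom.ofInjective hf).symm.toMonoidHom
    (MonoidHom.ofInjective hf).symm.surjective (C.mem_subgroup K f.range hK)

variable {C} in
theorem mem_prod {H K : Type u} [Group H] [Group K] (hH : C.Mem H) (hK : C.Mem K) :
    C.Mem (H × K) := by
  refine C.mem_extension (H × K) (MonoidHom.fst H K).ker ?_ ?_
  · refine mem_of_injective ((MonoidHom.snd H K).comp (MonoidHom.fst H K).ker.subtype) ?_ hK
    rintro ⟨⟨a, b⟩, h1⟩ ⟨⟨c, d⟩, h2⟩ h
    have h1' : a = 1 := h1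
    have h2' : c = 1 := h2
    have h' : b = d := h
    subst h1' h2' h'
    rfl
  · exact mem_of_injective (QuotientGroup.kerLift (MonoidHom.fst H K))
      (QuotientGroup.kerLift_injective _) hH

variable {C R} in
theorem mem_quotient_inf (M N : Subgroup R) [M.Normal] [N.Normal]
    (hM : C.Mem (R ⧸ M)) (hN : C.Mem (R ⧸ N)) : C.Mem (R ⧸ (M ⊓ N)) := by
  refine mem_of_injective
    (QuotientGroup.lift (M ⊓ N) ((QuotientGroup.mk' M).prod (QuotientGroup.mk' N)) ?_)
    ?_ (mem_prod hM hN)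
  · intro x hx
    exact Prod.ext ((QuotientGroup.eq_one_iff x).2 hx.1) ((QuotientGroup.eq_one_iff x).2 hx.2)
  · refine (injective_iff_map_eq_one _).2 fun x => ?_
    induction x using QuotientGroup.induction_on with
    | H z =>
      intro h
      have h1 : (z : R ⧸ M) = 1 := congrArg Prod.fst h
      have h2 : (z : R ⧸ N) = 1 := congrArg Prod.snd h
      exact (QuotientGroup.eq_one_iff z).2
        ⟨(QuotientGroup.eq_one_iff z).1 h1, (QuotientGroup.eq_one_iff z).1 h2⟩

/-- The (full) pro-`C` topology of `R`: the normal subgroups `N` with `R/N ∈ C` form a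
fundamental system of neighbourhoods of `1` (and their cosets of the other points). -/
@[reducible] def proTopology : TopologicalSpace R where
  IsOpen S := ∀ x ∈ S, ∃ N : C.NormalSub R, ∀ n ∈ N.toSubgroup, x * n ∈ S
  isOpen_univ := by
    intro x _
    obtain ⟨H, hG, hH⟩ := C.exists_mem
    refine ⟨⟨⊤, inferInstance, ?_⟩, fun _ _ => trivial⟩
    exact C.mem_image H (R ⧸ (⊤ : Subgroup R)) 1
      (fun y => ⟨1, QuotientGroup.subsingleton_quotient_top.elim _ _⟩) hH
  isOpen_inter := by
    intro S T hS hT x hx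
    obtain ⟨M, hM⟩ := hS x hx.1
    obtain ⟨N, hN⟩ := hT x hx.2
    exact ⟨⟨M.toSubgroup ⊓ N.toSubgroup, inferInstance, mem_quotient_inf _ _ M.mem N.mem⟩,
      fun n hn => ⟨hM n hn.1, hN n hn.2⟩⟩
  isOpen_sUnion := by
    intro S hS x hx
    obtain ⟨T, hT, hxT⟩ := hx
    obtain ⟨N, hN⟩ := hS T hT x hxT
    exact ⟨N, fun n hn => ⟨T, hT, hN n hn⟩⟩

variable {R} in
/-- `U` is open in the pro-`C` topology of the ambient group. -/
def IsOpenSubgroup (U : Subgroup R) : Prop :=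
  @IsOpen R (C.proTopology R) (U : Set R)

variable {C R} in
/-- An open normal subgroup has its quotient in `C`. -/
theorem IsOpenSubgroup.mem_quotient {U : Subgroup R} [U.Normal] (hU : C.IsOpenSubgroup U) :
    C.Mem (R ⧸ U) := by
  obtain ⟨N, hN⟩ := hU 1 U.one_mem
  have hle : N.toSubgroup ≤ U := fun n hn => by simpa using hN n hn
  refine C.mem_image (R ⧸ N.toSubgroup) (R ⧸ U)
    (QuotientGroup.map N.toSubgroup U (MonoidHom.id R) hle) ?_ N.mem
  intro y
  induction y using QuotientGroup.induction_on with
  | H z => exact ⟨(z : R ⧸ N.toSubgroup), rfl⟩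

/-- `R` is residually `C`: the intersection of all normal `N` with `R/N ∈ C` is trivial. -/
def Residually : Prop := ⨅ N : C.NormalSub R, N.toSubgroup = ⊥

/-- The pro-`C` completion of `R`: the inverse limit of the quotients `R/N ∈ C`, as the group of
compatible families. -/
def completion : Subgroup (∀ N : C.NormalSub R, R ⧸ N.toSubgroup) where
  carrier := {x | ∀ (M N : C.NormalSub R) (h : M.toSubgroup ≤ N.toSubgroup),
    QuotientGroup.map M.toSubgroup N.toSubgroup (MonoidHom.id R) h (x M) = x N}
  one_mem' := fun M N h => by simp
  mul_mem' := fun {x y} hx hy M N h => by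
    rw [Pi.mul_apply, Pi.mul_apply, map_mul, hx M N h, hy M N h]
  inv_mem' := fun {x} hx M N h => by
    rw [Pi.inv_apply, Pi.inv_apply, map_inv, hx M N h]

/-- The natural homomorphism from `R` to its pro-`C` completion. -/
def toCompletion : R →* C.completion R where
  toFun r := ⟨fun N => (r : R ⧸ N.toSubgroup), fun _ _ _ => rfl⟩
  map_one' := rfl
  map_mul' _ _ := rfl

end ExtClosedPseudovariety

/-! ## Graphs -/

/-- An (oriented) graph with vertex set `V`, edge set `E` and incidence maps `d0`, `d1`.  As a
single set it is the disjoint union of `V` and `E`, with `d0`, `d1` the identity on `V`. -/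
structure OrGraph where
  V : Type u
  E : Type u
  d0 : E → V
  d1 : E → V
  nonempty : Nonempty V

namespace OrGraph

variable (Γ : OrGraph.{u})

/-- The initial vertex of a signed edge: `(e, true)` is `e` traversed from `d0 e` to `d1 e`, and
`(e, false)` is `e` traversed backwards. -/
def src (s : Γ.E × Bool) : Γ.V := if s.2 then Γ.d0 s.1 else Γ.d1 s.1

/-- The terminal vertex of a signed edge. -/
def tgt (s : Γ.E × Bool) : Γ.V := if s.2 then Γ.d1 s.1 else Γ.d0 s.1

/-- `l` is the sequence of signed edges of a path from `v` to `w`. -/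
def IsPath : Γ.V → List (Γ.E × Bool) → Γ.V → Prop
  | v, [], w => v = w
  | v, s :: l, w => Γ.src s = v ∧ IsPath (Γ.tgt s) l w

/-- Any two vertices are joined by a path. -/
def Connected : Prop := ∀ v w : Γ.V, ∃ l, Γ.IsPath v l w

/-- `T` is the edge set of a maximal subtree: the subgraph with all the vertices and with edge set
`T` is connected and has no nonempty closed path without backtracking. -/
def IsMaximalSubtree (T : Set Γ.E) : Prop :=
  (∀ v w : Γ.V, ∃ l, (∀ s ∈ l, s.1 ∈ T) ∧ Γ.IsPath v l w) ∧
  (∀ (v : Γ.V) (l : List (Γ.E × Bool)), (∀ s ∈ l, s.1 ∈ T) → FreeGroup.IsReduced l →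
    Γ.IsPath v l v → l = [])

end OrGraph

/-! ## Graphs of groups and their fundamental groups -/

/-- A graph of groups over a connected graph: vertex groups, edge groups, and injective
homomorphisms `∂0`, `∂1` from the edge groups to the groups of the endpoints. -/
structure GraphOfGroups extends OrGraph.{u} where
  connected : toOrGraph.Connected
  GV : V → Type u
  GE : E → Type u
  [groupV : ∀ v, Group (GV v)]
  [groupE : ∀ e, Group (GE e)]
  b0 : ∀ e, GE e →* GV (d0 e)
  b1 : ∀ e, GE e →* GV (d1 e)
  b0_injective : ∀ e, Function.Injective (b0 e)
  b1_injective : ∀ e, Function.Injective (b1 e)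

namespace GraphOfGroups

attribute [instance] groupV groupE

variable (𝒢 : GraphOfGroups.{u})

/-- Reduced: for an edge `e` that is not a loop, both images of the edge group are proper subgroups
of the vertex groups. -/
def IsReduced : Prop :=
  ∀ e : 𝒢.E, 𝒢.d0 e ≠ 𝒢.d1 e → (𝒢.b0 e).range ≠ ⊤ ∧ (𝒢.b1 e).range ≠ ⊤

/-- The free product of all vertex groups and of the free group on the edges. -/
abbrev W : Type u := Monoid.Coprod (Monoid.CoprodI 𝒢.GV) (FreeGroup 𝒢.E)

/-- The image of a vertex group element in `W`. -/
def wVert (v : 𝒢.V) : 𝒢.GV v →* 𝒢.W :=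
  (Monoid.Coprod.inl).comp (Monoid.CoprodI.of (i := v))

/-- The image of an edge in `W`. -/
def wEdge (e : 𝒢.E) : 𝒢.W := Monoid.Coprod.inr (FreeGroup.of e)

/-- The relators `∂0(x)⁻¹ e ∂1(x) e⁻¹`, for `x` in the group of the edge `e`. -/
def relators : Set 𝒢.W :=
  {r | ∃ (e : 𝒢.E) (x : 𝒢.GE e),
    r = (𝒢.wVert _ (𝒢.b0 e x))⁻¹ * 𝒢.wEdge e * 𝒢.wVert _ (𝒢.b1 e x) * (𝒢.wEdge e)⁻¹}

/-- The path group `F(𝒢, Γ)`. -/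
abbrev PathGroup : Type u := 𝒢.W ⧸ Subgroup.normalClosure 𝒢.relators

/-- The image of a vertex group in the path group. -/
def vert (v : 𝒢.V) : 𝒢.GV v →* 𝒢.PathGroup := (QuotientGroup.mk' _).comp (𝒢.wVert v)

/-- The image of an edge in the path group. -/
def edge (e : 𝒢.E) : 𝒢.PathGroup := QuotientGroup.mk' _ (𝒢.wEdge e)

/-- The image of a signed edge in the path group. -/
def sEdge (s : 𝒢.E × Bool) : 𝒢.PathGroup := if s.2 then 𝒢.edge s.1 else (𝒢.edge s.1)⁻¹

/-- `IsWord v w x`: the element `x` of the path group has the form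
`|c, μ| = g₀ e₀ g₁ e₁ ⋯ gₙ` for a path `c` from `v` to `w` and elements `gᵢ` of the groups of the
successive vertices of `c`. -/
inductive IsWord : 𝒢.V → 𝒢.V → 𝒢.PathGroup → Prop
  | single (v : 𝒢.V) (g : 𝒢.GV v) : IsWord v v (𝒢.vert v g)
  | cons (s : 𝒢.E × Bool) (g : 𝒢.GV (𝒢.src s)) {w : 𝒢.V} {x : 𝒢.PathGroup}
      (hx : IsWord (𝒢.tgt s) w x) : IsWord (𝒢.src s) w (𝒢.vert (𝒢.src s) g * 𝒢.sEdge s * x)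

variable {𝒢}

theorem IsWord.vert_mul {v w : 𝒢.V} {x : 𝒢.PathGroup} (h : 𝒢.IsWord v w x) (g : 𝒢.GV v) :
    𝒢.IsWord v w (𝒢.vert v g * x) := by
  cases h with
  | single _ g' => rw [← map_mul]; exact .single _ _
  | cons s g' hx =>
    rw [← mul_assoc, ← mul_assoc, ← map_mul]; exact .cons s _ hx

theorem IsWord.mul {u v w : 𝒢.V} {x y : 𝒢.PathGroup} (hx : 𝒢.IsWord u v x)
    (hy : 𝒢.IsWord v w y) : 𝒢.IsWord u w (x * y) := by
  induction hx with
  | single v g => exact hy.vert_mul g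
  | cons s g _ ih => rw [mul_assoc]; exact .cons s g (ih hy)

theorem IsWord.sEdge_inv (s : 𝒢.E × Bool) : 𝒢.IsWord (𝒢.tgt s) (𝒢.src s) (𝒢.sEdge s)⁻¹ := by
  obtain ⟨e, b⟩ := s
  cases b
  · have h := IsWord.cons (𝒢 := 𝒢) (e, true) 1 (.single _ 1)
    rw [map_one, map_one, one_mul, mul_one] at h
    simpa [sEdge, OrGraph.src, OrGraph.tgt] using h
  · have h := IsWord.cons (𝒢 := 𝒢) (e, false) 1 (.single _ 1)
    rw [map_one, map_one, one_mul, mul_one] at h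
    simpa [sEdge, OrGraph.src, OrGraph.tgt] using h

theorem IsWord.inv {u v : 𝒢.V} {x : 𝒢.PathGroup} (hx : 𝒢.IsWord u v x) :
    𝒢.IsWord v u x⁻¹ := by
  induction hx with
  | single v g => rw [← map_inv]; exact .single _ _
  | cons s g _ ih =>
    rw [mul_inv_rev, mul_inv_rev, ← map_inv]
    exact ih.mul ((IsWord.sEdge_inv s).mul (.single _ _))

variable (𝒢)

/-- The fundamental group `π₁(𝒢, Γ, v)` at the vertex `v`. -/
def fundamentalGroupAt (v : 𝒢.V) : Subgroup 𝒢.PathGroup where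
  carrier := {x | 𝒢.IsWord v v x}
  one_mem' := by
    have h := IsWord.single (𝒢 := 𝒢) v 1
    rwa [map_one] at h
  mul_mem' := fun hx hy => hx.mul hy
  inv_mem' := fun hx => hx.inv

/-- The homomorphism `g ↦ p g p⁻¹` from the group of `w` to `π₁(𝒢, Γ, v)` given by a word `p`
whose path leads from `v` to `w`. -/
def vertToAt {v w : 𝒢.V} {p : 𝒢.PathGroup} (hp : 𝒢.IsWord v w p) :
    𝒢.GV w →* 𝒢.fundamentalGroupAt v where
  toFun g := ⟨p * 𝒢.vert w g * p⁻¹, (hp.mul (.single w g)).mul hp.inv⟩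
  map_one' := by ext; simp
  map_mul' a b := by ext; simp

/-- A finite graph of finite groups in `C` is injective if all its vertex and edge groups embed in
its pro-`C` fundamental group, the pro-`C` completion of `π₁(𝒢, Γ, v)`.  The group of a vertex `w`
is mapped there along a path from `v` to `w`, the group of an edge `e` through `∂0`; the choice of
the path and of the base point does not matter, and all of them are considered. -/
def IsInjective (C : ExtClosedPseudovariety.{u}) : Prop :=
  (∀ (v w : 𝒢.V) (p : 𝒢.PathGroup) (hp : 𝒢.IsWord v w p), Function.Injective
    ((C.toCompletion (𝒢.fundamentalGroupAt v)).comp (𝒢.vertToAt hp))) ∧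
  (∀ (v : 𝒢.V) (e : 𝒢.E) (p : 𝒢.PathGroup) (hp : 𝒢.IsWord v (𝒢.d0 e) p), Function.Injective
    ((C.toCompletion (𝒢.fundamentalGroupAt v)).comp ((𝒢.vertToAt hp).comp (𝒢.b0 e))))

variable (T : Set 𝒢.E)

/-- The fundamental group `π₁(𝒢, Γ, T)` with respect to a maximal subtree with edge set `T`: the
quotient of the path group obtained by putting `e = 1` for all `e ∈ T`. -/
abbrev FundamentalGroup : Type u := 𝒢.PathGroup ⧸ Subgroup.normalClosure (𝒢.edge '' T)

/-- The canonical map of a vertex group to the fundamental group. -/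
def vertHom (v : 𝒢.V) : 𝒢.GV v →* 𝒢.FundamentalGroup T := (QuotientGroup.mk' _).comp (𝒢.vert v)

/-- The canonical map of an edge group to the fundamental group; it factors through `∂0`. -/
def edgeHom (e : 𝒢.E) : 𝒢.GE e →* 𝒢.FundamentalGroup T := (𝒢.vertHom T (𝒢.d0 e)).comp (𝒢.b0 e)

/-- The element `t_e` of the fundamental group given by an edge `e`; it is `1` for `e ∈ T`. -/
def stable (e : 𝒢.E) : 𝒢.FundamentalGroup T := QuotientGroup.mk' _ (𝒢.edge e)

variable {T} in
theorem edgeHom_eq (e : 𝒢.E) (x : 𝒢.GE e) :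
    𝒢.edgeHom T e x = 𝒢.stable T e * 𝒢.vertHom T _ (𝒢.b1 e x) * (𝒢.stable T e)⁻¹ := by
  have h : 𝒢.vert _ (𝒢.b0 e x) = 𝒢.edge e * 𝒢.vert _ (𝒢.b1 e x) * (𝒢.edge e)⁻¹ := by
    have h1 : (QuotientGroup.mk' (Subgroup.normalClosure 𝒢.relators))
        ((𝒢.wVert _ (𝒢.b0 e x))⁻¹ * 𝒢.wEdge e * 𝒢.wVert _ (𝒢.b1 e x) * (𝒢.wEdge e)⁻¹) = 1 :=
      (QuotientGroup.eq_one_iff _).2 (Subgroup.subset_normalClosure ⟨e, x, rfl⟩)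
    rw [map_mul, map_mul, map_mul, map_inv, map_inv, mul_assoc, mul_assoc,
      inv_mul_eq_one] at h1
    rw [mul_assoc]
    exact h1
  change (QuotientGroup.mk' _) (𝒢.vert _ (𝒢.b0 e x)) = _
  rw [h, map_mul, map_mul, map_inv]
  rfl

/-! ## The finite quotient graphs of groups -/

variable {T} (U : Subgroup (𝒢.FundamentalGroup T)) [U.Normal]

/-- The vertex group `𝒢_U(v) = 𝒢(v)U/U`, as a subgroup of `G/U`. -/
def vertImage (v : 𝒢.V) : Subgroup (𝒢.FundamentalGroup T ⧸ U) :=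
  (𝒢.vertHom T v).range.map (QuotientGroup.mk' U)

/-- The edge group `𝒢_U(e) = 𝒢(e)U/U`, as a subgroup of `G/U`. -/
def edgeImage (e : 𝒢.E) : Subgroup (𝒢.FundamentalGroup T ⧸ U) :=
  (𝒢.edgeHom T e).range.map (QuotientGroup.mk' U)

/-- The image `t_e U` of `t_e` in `G/U`. -/
def stableImage (e : 𝒢.E) : 𝒢.FundamentalGroup T ⧸ U := QuotientGroup.mk' U (𝒢.stable T e)

/-- Vertices `v`, `w` are equivalent modulo `U` if `𝒢_U(v) = 𝒢_U(w)`. -/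
def vertSetoid : Setoid 𝒢.V := Setoid.comap (𝒢.vertImage U) ⊥

/-- An equivalence relation on the edges of `Γ`, with finitely many classes, such that equivalent
edges have equivalent endpoints modulo `U` and such that the formulas `𝒢_U([e]) = 𝒢(e)U/U` and
`∂ᵢ(gU) = ∂ᵢ(g)U` do not depend on the choice of `e` in its class.  Since `∂0(x) = x` and
`∂1(x) = t_e⁻¹ x t_e` inside `G`, the latter says that equivalent edges have the same edge group in
`G/U` and that the two conjugations agree on it. -/
structure EdgeRel extends Setoid 𝒢.E where
  finite_classes : Finite (Quotient toSetoid)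
  d0_rel : ∀ {e e' : 𝒢.E}, r e e' → 𝒢.vertImage U (𝒢.d0 e) = 𝒢.vertImage U (𝒢.d0 e')
  d1_rel : ∀ {e e' : 𝒢.E}, r e e' → 𝒢.vertImage U (𝒢.d1 e) = 𝒢.vertImage U (𝒢.d1 e')
  edge_rel : ∀ {e e' : 𝒢.E}, r e e' → 𝒢.edgeImage U e = 𝒢.edgeImage U e'
  conj_rel : ∀ {e e' : 𝒢.E}, r e e' → ∀ x ∈ 𝒢.edgeImage U e,
    (𝒢.stableImage U e)⁻¹ * x * 𝒢.stableImage U e =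
      (𝒢.stableImage U e')⁻¹ * x * 𝒢.stableImage U e'

/-- Such relations exist when `G/U` is finite: identify `e` with `e'` when their endpoints are
equivalent, `𝒢_U(e) = 𝒢_U(e')` and `t_e U = t_{e'} U`. -/
def standardEdgeRel [Finite (𝒢.FundamentalGroup T ⧸ U)] : 𝒢.EdgeRel U where
  toSetoid := Setoid.comap (fun e => (𝒢.vertImage U (𝒢.d0 e), 𝒢.vertImage U (𝒢.d1 e),
    𝒢.edgeImage U e, 𝒢.stableImage U e)) ⊥
  finite_classes := by
    refine Finite.of_injective (β := Subgroup (𝒢.FundamentalGroup T ⧸ U) ×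
      Subgroup (𝒢.FundamentalGroup T ⧸ U) × Subgroup (𝒢.FundamentalGroup T ⧸ U) ×
      (𝒢.FundamentalGroup T ⧸ U)) (Quotient.lift _ fun _ _ h => h) ?_
    intro a b
    induction a using Quotient.inductionOn
    induction b using Quotient.inductionOn
    exact fun h => Quotient.sound h
  d0_rel := fun h => congrArg (fun q => q.1) h
  d1_rel := fun h => congrArg (fun q => q.2.1) h
  edge_rel := fun h => congrArg (fun q => q.2.2.1) h
  conj_rel := fun h x _ => by
    rw [show 𝒢.stableImage U _ = 𝒢.stableImage U _ from congrArg (fun q => q.2.2.2) h]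

variable {U} (r : 𝒢.EdgeRel U)

variable (U) in
/-- The quotient vertex set. -/
abbrev QuotV : Type u := Quotient (𝒢.vertSetoid U)

variable {𝒢} in
/-- The quotient edge set. -/
abbrev EdgeRel.QuotE : Type u := Quotient r.toSetoid

variable (U) in
/-- `𝒢_U([v])`. -/
def quotVertGroup : 𝒢.QuotV U → Subgroup (𝒢.FundamentalGroup T ⧸ U) :=
  Quotient.lift (𝒢.vertImage U) fun _ _ h => h

variable {𝒢} in
/-- `𝒢_U([e])`. -/
def EdgeRel.quotEdgeGroup : r.QuotE → Subgroup (𝒢.FundamentalGroup T ⧸ U) :=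
  Quotient.lift (𝒢.edgeImage U) fun _ _ h => r.edge_rel h

variable {𝒢} in
/-- The quotient graph `Γ_U`. -/
def EdgeRel.quotGraph : OrGraph.{u} where
  V := 𝒢.QuotV U
  E := r.QuotE
  d0 := Quotient.map (sa := r.toSetoid) (sb := 𝒢.vertSetoid U) 𝒢.d0 fun _ _ h => r.d0_rel h
  d1 := Quotient.map (sa := r.toSetoid) (sb := 𝒢.vertSetoid U) 𝒢.d1 fun _ _ h => r.d1_rel h
  nonempty := 𝒢.nonempty.map fun v => Quotient.mk (𝒢.vertSetoid U) v

variable {𝒢} in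
theorem EdgeRel.quotGraph_connected : r.quotGraph.Connected := by
  have key : ∀ (l : List (𝒢.E × Bool)) (v w : 𝒢.V), 𝒢.IsPath v l w →
      r.quotGraph.IsPath (Quotient.mk (𝒢.vertSetoid U) v)
        (l.map fun s => (Quotient.mk r.toSetoid s.1, s.2))
        (Quotient.mk (𝒢.vertSetoid U) w) := by
    intro l
    induction l with
    | nil => intro v w h; exact congrArg _ h
    | cons s l ih =>
      intro v w h
      obtain ⟨e, b⟩ := s
      obtain ⟨h1, h2⟩ := h
      have := ih _ _ h2
      cases b
      · exact ⟨congrArg (Quotient.mk (𝒢.vertSetoid U)) h1, this⟩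
      · exact ⟨congrArg (Quotient.mk (𝒢.vertSetoid U)) h1, this⟩
  intro a b
  induction a using Quotient.inductionOn with | _ v
  induction b using Quotient.inductionOn with | _ w
  obtain ⟨l, hl⟩ := 𝒢.connected v w
  exact ⟨_, key l v w hl⟩

variable {𝒢} in
/-- `t_e U` for a representative `e` of a class of edges. -/
noncomputable def EdgeRel.quotStable (q : r.QuotE) : 𝒢.FundamentalGroup T ⧸ U :=
  𝒢.stableImage U (Quotient.out q)

variable {𝒢} in
theorem EdgeRel.quotEdgeGroup_le (q : r.QuotE) :
    r.quotEdgeGroup q ≤ 𝒢.quotVertGroup U (r.quotGraph.d0 q) := by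
  induction q using Quotient.inductionOn with | _ e
  change 𝒢.edgeImage U e ≤ 𝒢.vertImage U (𝒢.d0 e)
  refine Subgroup.map_mono ?_
  rintro _ ⟨x, rfl⟩
  exact ⟨𝒢.b0 e x, rfl⟩

variable (U) in
theorem conj_mem (e : 𝒢.E) {x : 𝒢.FundamentalGroup T ⧸ U} (hx : x ∈ 𝒢.edgeImage U e) :
    (𝒢.stableImage U e)⁻¹ * x * 𝒢.stableImage U e ∈ 𝒢.vertImage U (𝒢.d1 e) := by
  obtain ⟨_, ⟨x, rfl⟩, rfl⟩ := hx
  refine ⟨𝒢.vertHom T _ (𝒢.b1 e x), ⟨_, rfl⟩, ?_⟩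
  rw [edgeHom_eq, map_mul, map_mul, map_inv]
  simp [stableImage, mul_assoc]

variable {𝒢} in
theorem EdgeRel.quot_conj_mem (q : r.QuotE) {x : 𝒢.FundamentalGroup T ⧸ U}
    (hx : x ∈ r.quotEdgeGroup q) :
    (r.quotStable q)⁻¹ * x * r.quotStable q ∈ 𝒢.quotVertGroup U (r.quotGraph.d1 q) := by
  have hq : Quotient.mk r.toSetoid (Quotient.out q) = q := Quotient.out_eq q
  have hx' : x ∈ 𝒢.edgeImage U (Quotient.out q) := by
    rw [← hq] at hx; exact hx
  have h := 𝒢.conj_mem U (Quotient.out q) hx'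
  have h2 : 𝒢.quotVertGroup U (r.quotGraph.d1 (Quotient.mk r.toSetoid (Quotient.out q))) =
    𝒢.vertImage U (𝒢.d1 (Quotient.out q)) := rfl
  rw [hq] at h2
  rw [h2]
  exact h

variable {𝒢} in
/-- The finite graph of groups `(𝒢_U, Γ_U)`: its vertex and edge groups are the subgroups
`𝒢(m)U/U` of `G/U`, with `∂0` the inclusion and `∂1` conjugation by `t_e U`, that is, with
`∂ᵢ(gU) = ∂ᵢ(g)U`. -/
noncomputable def EdgeRel.quot : GraphOfGroups.{u} where
  toOrGraph := r.quotGraph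
  connected := r.quotGraph_connected
  GV := fun q => 𝒢.quotVertGroup U q
  GE := fun q => r.quotEdgeGroup q
  groupV := fun _ => inferInstance
  groupE := fun _ => inferInstance
  b0 := fun q => Subgroup.inclusion (r.quotEdgeGroup_le q)
  b1 := fun q =>
    { toFun := fun x => ⟨(r.quotStable q)⁻¹ * x * r.quotStable q, r.quot_conj_mem q x.2⟩
      map_one' := by ext; simp
      map_mul' := fun x y => by ext; simp [mul_assoc] }
  b0_injective := fun q => Subgroup.inclusion_injective _
  b1_injective := fun q x y h => by
    have h' := congrArg Subtype.val h
    exact Subtype.ext (mul_left_cancel (mul_right_cancel h'))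

variable {𝒢} in
/-- The formula `∂1(gU) = ∂1(g)U`, for every representative of a class of edges. -/
theorem EdgeRel.quot_b1 (e : 𝒢.E) (x : 𝒢.GE e) :
    (r.quot.b1 (Quotient.mk r.toSetoid e)
      ⟨QuotientGroup.mk' U (𝒢.edgeHom T e x), ⟨_, ⟨x, rfl⟩, rfl⟩⟩ :
        𝒢.quotVertGroup U (r.quotGraph.d1 (Quotient.mk r.toSetoid e))).1 =
      QuotientGroup.mk' U (𝒢.vertHom T _ (𝒢.b1 e x)) := by
  have hr : r.toSetoid e (Quotient.out (Quotient.mk r.toSetoid e)) :=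
    r.toSetoid.symm (Quotient.mk_out (s := r.toSetoid) e)
  have h := r.conj_rel hr (QuotientGroup.mk' U (𝒢.edgeHom T e x)) ⟨_, ⟨x, rfl⟩, rfl⟩
  refine Eq.trans h.symm ?_
  rw [edgeHom_eq, map_mul, map_mul, map_inv]
  simp [stableImage, mul_assoc]

variable {𝒢} in
/-- The image `v_U` in `Γ_U` of a vertex `v` of `Γ`. -/
def EdgeRel.quotVertex (v : 𝒢.V) : r.quot.V := Quotient.mk (𝒢.vertSetoid U) v

end GraphOfGroups

/-!
The formulas defining `(𝒢_U, Γ_U)` give a homomorphism from its path group to `G/U ∈ C` that is the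
inclusion on every vertex group (`EdgeRel.toQuotient`).  Its restriction to the fundamental group at
any vertex separates the elements of the conjugates of the vertex groups, and this is injectivity
(`isInjective_of_hom`).  It also makes the kernel of this restriction a free group, which is why the
fundamental group is residually `C`.

The proof of the latter avoids free groups and Bass–Serre theory.  Let `f` be a homomorphism from a
path group to a group `Q ∈ C` that is injective on the vertex groups.  The cosets in `Q` of the
images of the vertex and edge groups form a graph, and words lift to paths in it.  Counting the
passages of these paths through the edges, with values in a nontrivial group `M ∈ C`, extends `f` to
a homomorphism to the wreath product of `M^E` by `Q`, which is again in `C` because `C` is closed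
under extensions (`wreathHom`).  If closed reduced words of length at most `n` have open lifts for
`f`, then the lift of a closed reduced word of length `n + 1` passes through its first edge only
once, so that closed reduced words of length at most `n + 1` have nontrivial values, and indeed
values outside the vertex group, in the wreath product (`Separates.wreathHom`).  By iteration, every
nontrivial element of the fundamental group has a nontrivial image in some group in `C`.

The group `M` exists as soon as `C` contains a nontrivial group.  Since `G` is residually `C`, this
holds if `G` is nontrivial, and `G` is nontrivial if `Γ` has an edge
(`nontrivial_fundamentalGroup`): a loop has infinite order in `G`, and at an edge that is not a loop
there is a nontrivial vertex group, because `𝒢` is reduced.  Vertex groups embed in `G` by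
`vertHom_injective`, which is proved with a permutation representation of the path group.
-/

/-! ### Classes of finite groups -/

namespace ExtClosedPseudovariety

variable {C : ExtClosedPseudovariety.{u}}

theorem mem_of_subsingleton (C : ExtClosedPseudovariety.{u}) (K : Type u) [Group K]
    [Subsingleton K] : C.Mem K := by
  obtain ⟨H, hG, hH⟩ := C.exists_mem
  exact C.mem_image H K 1 (fun y => ⟨1, Subsingleton.elim _ _⟩) hH

theorem mem_pi {M : Type u} [Group M] (hM : C.Mem M) (ι : Type u) [Finite ι] :
    C.Mem (ι → M) := by
  induction ι using Finite.induction_empty_option with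
  | of_equiv e h =>
    exact mem_of_injective ⟨⟨fun g => g ∘ e, rfl⟩, fun _ _ => rfl⟩
      e.surjective.injective_comp_right h
  | h_empty => exact mem_of_subsingleton C _
  | @h_option ι _ h =>
    refine mem_of_injective (K := M × (ι → M))
      ⟨⟨fun f => (f none, fun i => f (some i)), rfl⟩, fun _ _ => rfl⟩ ?_ (mem_prod hM h)
    intro f g hfg
    funext i
    cases i with
    | none => exact congrArg Prod.fst hfg
    | some i => exact congrFun (congrArg Prod.snd hfg) i

theorem mem_regularWreathProduct {D Q : Type u} [Group D] [Group Q] (hD : C.Mem D)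
    (hQ : C.Mem Q) : C.Mem (D ≀ᵣ Q) := by
  have := C.finite_of_mem Q hQ
  refine C.mem_extension _ (RegularWreathProduct.rightHom (D := D) (Q := Q)).ker ?_
    (mem_of_injective _ (QuotientGroup.kerLift_injective RegularWreathProduct.rightHom) hQ)
  refine mem_of_injective (K := Q → D) ⟨⟨fun a => a.1.left, rfl⟩, ?_⟩ ?_ (mem_pi hD Q)
  · intro a b
    have ha : a.1.right = 1 := a.2
    funext q
    simp [ha]
  · intro a b hab
    have ha : a.1.right = 1 := a.2
    have hb : b.1.right = 1 := b.2
    exact Subtype.ext (RegularWreathProduct.ext hab (ha.trans hb.symm))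

/-- Being residually `C` only has to be checked on homomorphisms to groups in `C`. -/
theorem residually_of_forall_hom {R : Type u} [Group R]
    (h : ∀ x : R, x ≠ 1 → ∃ (Q : Type u) (_ : Group Q) (f : R →* Q), C.Mem Q ∧ f x ≠ 1) :
    C.Residually R := by
  refine (Subgroup.eq_bot_iff_forall _).2 fun x hx => by_contra fun hne => ?_
  obtain ⟨Q, _, f, hQ, hfx⟩ := h x hne
  exact hfx ((Subgroup.mem_iInf.1 hx)
    ⟨f.ker, inferInstance, mem_of_injective _ (QuotientGroup.kerLift_injective f) hQ⟩)

theorem exists_nontrivial_mem_of_residually {R : Type u} [Group R] [Nontrivial R]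
    (h : C.Residually R) : ∃ (M : Type u) (_ : Group M), Nontrivial M ∧ C.Mem M := by
  obtain ⟨x, hx⟩ := exists_ne (1 : R)
  have hx' : x ∉ ⨅ N : C.NormalSub R, N.toSubgroup := by
    rw [show (⨅ N : C.NormalSub R, N.toSubgroup) = ⊥ from h]
    exact hx
  rw [Subgroup.mem_iInf, not_forall] at hx'
  obtain ⟨N, hN⟩ := hx'
  exact ⟨R ⧸ N.toSubgroup, inferInstance,
    ⟨(x : R ⧸ N.toSubgroup), 1, fun h1 => hN ((QuotientGroup.eq_one_iff x).1 h1)⟩, N.mem⟩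

/-- An element with nontrivial image in a group of `C` has nontrivial image in the pro-`C`
completion. -/
theorem toCompletion_ne_one {R Q : Type u} [Group R] [Group Q] (f : R →* Q) (hQ : C.Mem Q) {x : R}
    (hx : f x ≠ 1) : C.toCompletion R x ≠ 1 := fun h => by
  have h1 := congrFun (congrArg Subtype.val h)
    ⟨f.ker, inferInstance, mem_of_injective _ (QuotientGroup.kerLift_injective f) hQ⟩
  exact hx ((QuotientGroup.eq_one_iff x).1 h1)

end ExtClosedPseudovariety

/-! ### Homomorphisms from the path group -/

namespace GraphOfGroups

variable (𝒢 : GraphOfGroups.{u})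

theorem vert_b0 (e : 𝒢.E) (x : 𝒢.GE e) :
    𝒢.vert _ (𝒢.b0 e x) = 𝒢.edge e * 𝒢.vert _ (𝒢.b1 e x) * (𝒢.edge e)⁻¹ := by
  have h1 : (QuotientGroup.mk' (Subgroup.normalClosure 𝒢.relators))
      ((𝒢.wVert _ (𝒢.b0 e x))⁻¹ * 𝒢.wEdge e * 𝒢.wVert _ (𝒢.b1 e x) * (𝒢.wEdge e)⁻¹) = 1 :=
    (QuotientGroup.eq_one_iff _).2 (Subgroup.subset_normalClosure ⟨e, x, rfl⟩)
  rw [map_mul, map_mul, map_mul, map_inv, map_inv, mul_assoc, mul_assoc, inv_mul_eq_one] at h1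
  rw [mul_assoc]
  exact h1

section lift

variable {K : Type*} [Group K] (a : ∀ v, 𝒢.GV v →* K) (t : 𝒢.E → K)
  (h : ∀ e x, a _ (𝒢.b0 e x) = t e * a _ (𝒢.b1 e x) * (t e)⁻¹)

/-- The universal property of the path group. -/
def pathLift : 𝒢.PathGroup →* K :=
  QuotientGroup.lift _ (Monoid.Coprod.lift (Monoid.CoprodI.lift a) (FreeGroup.lift t)) <| by
    refine Subgroup.normalClosure_le_normal (N := MonoidHom.ker _) ?_
    rintro _ ⟨e, x, rfl⟩
    have := h e x
    simp [wVert, wEdge, MonoidHom.mem_ker, this, mul_assoc]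

@[simp]
theorem pathLift_vert (v : 𝒢.V) (g : 𝒢.GV v) : 𝒢.pathLift a t h (𝒢.vert v g) = a v g := by
  simp [pathLift, vert, wVert]

@[simp]
theorem pathLift_edge (e : 𝒢.E) : 𝒢.pathLift a t h (𝒢.edge e) = t e := by
  simp [pathLift, edge, wEdge]

end lift

theorem pathGroup_hom_ext {K : Type*} [Group K] {f g : 𝒢.PathGroup →* K}
    (hv : ∀ v x, f (𝒢.vert v x) = g (𝒢.vert v x)) (he : ∀ e, f (𝒢.edge e) = g (𝒢.edge e)) :
    f = g := by
  refine QuotientGroup.monoidHom_ext _ (Monoid.Coprod.hom_ext (Monoid.CoprodI.ext_hom _ _ ?_)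
    (FreeGroup.ext_hom _ _ ?_))
  · exact fun v => MonoidHom.ext (hv v)
  · exact he

end GraphOfGroups

/-! ### Reduced words -/

namespace OrGraph

variable {Γ : OrGraph.{u}} {v w : Γ.V}

theorem isPath_append {l₁ l₂ : List (Γ.E × Bool)} :
    Γ.IsPath v (l₁ ++ l₂) w ↔ ∃ u, Γ.IsPath v l₁ u ∧ Γ.IsPath u l₂ w := by
  induction l₁ generalizing v with
  | nil => simp [IsPath]
  | cons s l ih => simp [IsPath, ih, and_assoc]

theorem isPath_invRev {l : List (Γ.E × Bool)} (h : Γ.IsPath v l w) :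
    Γ.IsPath w (FreeGroup.invRev l) v := by
  induction l generalizing v with
  | nil => exact Eq.symm h
  | cons s l ih =>
    obtain ⟨rfl, h⟩ := h
    have h1 : FreeGroup.invRev (s :: l) = FreeGroup.invRev l ++ [(s.1, !s.2)] := by
      simp [FreeGroup.invRev]
    rw [h1, isPath_append]
    refine ⟨_, ih h, ?_⟩
    obtain ⟨e, b⟩ := s
    cases b <;> exact ⟨rfl, rfl⟩

end OrGraph

namespace GraphOfGroups

variable (𝒢 : GraphOfGroups.{u})

/-- A signed edge preceded by an element of the group of its source. -/
abbrev Letter : Type u := Σ s : 𝒢.E × Bool, 𝒢.GV (𝒢.src s)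

variable {𝒢}

/-- The element `g₀ s₁ g₁ s₂ ⋯ gₙ₋₁ sₙ` of the path group. -/
def wordVal : List 𝒢.Letter → 𝒢.PathGroup
  | [] => 1
  | a :: l => 𝒢.vert _ a.2 * 𝒢.sEdge a.1 * wordVal l

/-- The same edge with the opposite sign. -/
def revEdge (s : 𝒢.E × Bool) : 𝒢.E × Bool := (s.1, !s.2)

theorem sEdge_revEdge (s : 𝒢.E × Bool) : 𝒢.sEdge (revEdge s) = (𝒢.sEdge s)⁻¹ := by
  obtain ⟨e, b⟩ := s
  cases b <;> simp [sEdge, revEdge]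

variable (𝒢) in
/-- The image in the path group of the edge group of `s`, embedded in the group of the source
of `s`. -/
def edgeRange (s : 𝒢.E × Bool) : Subgroup 𝒢.PathGroup :=
  if s.2 then ((𝒢.vert _).comp (𝒢.b0 s.1)).range else ((𝒢.vert _).comp (𝒢.b1 s.1)).range

/-- The defining relations of the path group, for both orientations of the edge. -/
theorem conj_mem_edgeRange (s : 𝒢.E × Bool) {x : 𝒢.PathGroup}
    (hx : x ∈ 𝒢.edgeRange (revEdge s)) : 𝒢.sEdge s * x * (𝒢.sEdge s)⁻¹ ∈ 𝒢.edgeRange s := by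
  obtain ⟨e, b⟩ := s
  cases b
  · obtain ⟨y, rfl⟩ : ∃ y, 𝒢.vert _ (𝒢.b0 e y) = x := hx
    refine ⟨y, ?_⟩
    change 𝒢.vert _ (𝒢.b1 e y) = (𝒢.edge e)⁻¹ * 𝒢.vert _ (𝒢.b0 e y) * (𝒢.edge e)⁻¹⁻¹
    simp [vert_b0, mul_assoc]
  · obtain ⟨y, rfl⟩ := hx
    exact ⟨y, 𝒢.vert_b0 e y⟩

theorem edgeRange_le (s : 𝒢.E × Bool) : 𝒢.edgeRange s ≤ (𝒢.vert (𝒢.src s)).range := by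
  obtain ⟨e, b⟩ := s
  cases b <;> (rintro _ ⟨y, rfl⟩; exact ⟨_, rfl⟩)

/-- No letter is cancelled by its successor: the word contains no `s g s⁻¹` with `g` in the image
of the edge group. -/
def IsReducedWord (l : List 𝒢.Letter) : Prop :=
  l.IsChain fun a b => b.1 = revEdge a.1 → 𝒢.vert _ b.2 ∉ 𝒢.edgeRange b.1

/-- The letters form a path from `v` to `w`. -/
def IsWordPath (v : 𝒢.V) (l : List 𝒢.Letter) (w : 𝒢.V) : Prop :=
  𝒢.IsPath v (l.map Sigma.fst) w

/-- A reduced word can absorb vertex group elements at both ends. -/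
theorem exists_vert_mul_wordVal {v w : 𝒢.V} {l : List 𝒢.Letter} (hp : IsWordPath v l w)
    (hr : IsReducedWord l) (g : 𝒢.GV v) (h : 𝒢.GV w) :
    ∃ (l' : List 𝒢.Letter) (h' : 𝒢.GV w), IsWordPath v l' w ∧ IsReducedWord l' ∧
      wordVal l' * 𝒢.vert w h' = 𝒢.vert v g * (wordVal l * 𝒢.vert w h) := by
  cases l with
  | nil =>
    obtain rfl : v = w := hp
    exact ⟨[], g * h, rfl, hr, by simp [wordVal]⟩
  | cons a l =>
    obtain ⟨s, k⟩ := a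
    obtain ⟨rfl, hp⟩ := hp
    refine ⟨⟨s, g * k⟩ :: l, h, ⟨rfl, hp⟩, ?_, by simp [wordVal, mul_assoc]⟩
    cases l with
    | nil => exact List.isChain_singleton _
    | cons b l =>
      obtain ⟨h1, h2⟩ := List.isChain_cons_cons.1 hr
      exact List.isChain_cons_cons.2 ⟨h1, h2⟩

/-- Every word can be made reduced: a letter `s` that cancels with its successor `s⁻¹` is removed,
and the element between them moves across `s` into the group of the source of `s`. -/
theorem IsWord.exists_reduced {v w : 𝒢.V} {x : 𝒢.PathGroup} (hx : 𝒢.IsWord v w x) :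
    ∃ (l : List 𝒢.Letter) (h : 𝒢.GV w), IsWordPath v l w ∧ IsReducedWord l ∧
      x = wordVal l * 𝒢.vert w h := by
  induction hx with
  | single v g => exact ⟨[], g, rfl, List.isChain_nil, by simp [wordVal]⟩
  | @cons s g w x _ ih =>
    obtain ⟨l, h, hp, hr, rfl⟩ := ih
    by_cases hl : IsReducedWord (⟨s, g⟩ :: l)
    · exact ⟨⟨s, g⟩ :: l, h, ⟨rfl, hp⟩, hl, by simp [wordVal, mul_assoc]⟩
    · cases l with
      | nil => exact absurd (List.isChain_singleton _) hl
      | cons b l =>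
        have hb : b.1 = revEdge s ∧ 𝒢.vert _ b.2 ∈ 𝒢.edgeRange b.1 := by
          by_contra hb
          exact hl (List.isChain_cons_cons.2 ⟨fun h1 h2 => hb ⟨h1, h2⟩, hr⟩)
        obtain ⟨t, k⟩ := b
        obtain ⟨rfl, hk⟩ := hb
        obtain ⟨y, hy⟩ := edgeRange_le s (conj_mem_edgeRange s hk)
        have hp' : IsWordPath (𝒢.src s) l w := by
          obtain ⟨e, b⟩ := s
          cases b <;> exact hp.2
        obtain ⟨l', h', h1, h2, h3⟩ := exists_vert_mul_wordVal hp' hr.tail (g * y) h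
        refine ⟨l', h', h1, h2, ?_⟩
        rw [h3, map_mul, hy]
        simp only [wordVal, sEdge_revEdge, mul_assoc]

/-! ### Separating reduced words in iterated wreath products -/

section wreath

variable {Q D : Type u} [Group Q] [Group D] (f : 𝒢.PathGroup →* Q) (z : D)

/-- The group `Q` acts on the graph whose vertices over `v` and edges over `e` are the left cosets
in `Q` of the images of the groups of `v` and `e` under `f`, where the edge `qB` over `e` leads from
the vertex represented by `q` to the one represented by `q * f (𝒢.edge e)`.  `OnEdge f s q` says
that `q` lies in the coset that is traversed, in one of its two directions, by the lift of `s`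
starting at the vertex represented by `1`. -/
def OnEdge (s : 𝒢.E × Bool) (q : Q) : Prop :=
  (if s.2 then q else f (𝒢.edge s.1) * q) ∈ (𝒢.edgeRange (s.1, true)).map f

open Classical in
/-- The lift of `f` to the wreath product of `D^E` by `Q` that sends `e` to the pair consisting of
the function on `Q × E` with the value `z` on the coset traversed by `e` and `1` elsewhere, and of
`f (𝒢.edge e)`.  The first component of the value of a word records the passages of its lift,
starting at the vertex represented by `1`, through the edges of the graph of cosets. -/
noncomputable def wreathHom : 𝒢.PathGroup →* (𝒢.E → D) ≀ᵣ Q :=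
  𝒢.pathLift (fun v => RegularWreathProduct.inl.comp (f.comp (𝒢.vert v)))
    (fun e => ⟨fun q e' => if e' = e ∧ OnEdge f (e, true) q then z else 1, f (𝒢.edge e)⟩) <| by
    intro e x
    have hx : f (𝒢.vert _ (𝒢.b0 e x)) ∈ (𝒢.edgeRange (e, true)).map f :=
      ⟨_, ⟨x, rfl⟩, rfl⟩
    refine RegularWreathProduct.ext ?_ (by simp [vert_b0])
    funext q e'
    have h1 : f (𝒢.edge e) * ((f (𝒢.vert _ (𝒢.b1 e x)))⁻¹ * ((f (𝒢.edge e))⁻¹ * q)) =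
        (f (𝒢.vert _ (𝒢.b0 e x)))⁻¹ * q := by simp [vert_b0, mul_assoc]
    have h2 : (f (𝒢.vert _ (𝒢.b0 e x)))⁻¹ * q ∈ (𝒢.edgeRange (e, true)).map f ↔
        q ∈ (𝒢.edgeRange (e, true)).map f :=
      Subgroup.mul_mem_cancel_left _ (Subgroup.inv_mem _ hx)
    simp [OnEdge, mul_assoc, h1, h2, -Subgroup.mem_map]

@[simp]
theorem wreathHom_right (x : 𝒢.PathGroup) : (wreathHom f z x).right = f x := by
  have : RegularWreathProduct.rightHom.comp (wreathHom f z) = f :=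
    𝒢.pathGroup_hom_ext (by simp [wreathHom]) (by simp [wreathHom])
  exact DFunLike.congr_fun this x

@[simp]
theorem wreathHom_vert_left (v : 𝒢.V) (g : 𝒢.GV v) : (wreathHom f z (𝒢.vert v g)).left = 1 := by
  simp [wreathHom]

variable {z} in
/-- The cosets traversed by the two directions of an edge are those where the first component of
its value is nontrivial. -/
theorem wreathHom_sEdge_left (hz : z ≠ 1) (s : 𝒢.E × Bool) (q : Q) (e : 𝒢.E) :
    (wreathHom f z (𝒢.sEdge s)).left q e ≠ 1 ↔ s.1 = e ∧ OnEdge f s q := by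
  classical
  have key : ∀ (P : Prop) [Decidable P], (if P then z else 1) ≠ 1 ↔ P := fun P _ => by
    split_ifs with h <;> simp [h, hz]
  obtain ⟨e', b⟩ := s
  cases b <;> simp only [wreathHom, sEdge, Bool.false_eq_true, if_true, if_false, map_inv,
    pathLift_edge, RegularWreathProduct.inv_left, Pi.inv_apply, ne_eq, inv_eq_one]
  · exact (key _).trans (and_congr_left' eq_comm)
  · exact (key _).trans (and_congr_left' eq_comm)

variable {z} in
/-- If the first component of the value of a word is nontrivial at an edge of the graph of cosets,
then the lift of the word passes through this edge: it does so at the letter `a`, after the initial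
segment `l₁`. -/
theorem exists_of_wreathHom_left_ne_one (hz : z ≠ 1) (l : List 𝒢.Letter) (q : Q) (e : 𝒢.E)
    (h : (wreathHom f z (wordVal l)).left q e ≠ 1) :
    ∃ l₁ a l₂, l = l₁ ++ a :: l₂ ∧ a.1.1 = e ∧
      OnEdge f a.1 ((f (wordVal l₁ * 𝒢.vert _ a.2))⁻¹ * q) := by
  induction l generalizing q with
  | nil => simp [wordVal] at h
  | cons a l ih =>
    by_cases ha : a.1.1 = e ∧ OnEdge f a.1 ((f (𝒢.vert _ a.2))⁻¹ * q)
    · exact ⟨[], a, l, rfl, ha.1, by simpa [wordVal] using ha.2⟩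
    · rw [← wreathHom_sEdge_left f hz, not_not] at ha
      simp only [wordVal, map_mul, RegularWreathProduct.mul_left, Pi.mul_apply, wreathHom_right,
        wreathHom_vert_left, one_mul, ha, RegularWreathProduct.mul_right] at h
      obtain ⟨l₁, b, l₂, rfl, h1, h2⟩ := ih _ h
      refine ⟨a :: l₁, b, l₂, rfl, h1, ?_⟩
      simpa [wordVal, mul_assoc] using h2

variable {f}

theorem exists_onEdge (s : 𝒢.E × Bool) : ∃ q : Q, OnEdge f s q := by
  obtain ⟨e, b⟩ := s
  cases b
  · exact ⟨(f (𝒢.edge e))⁻¹, by simp [OnEdge]⟩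
  · exact ⟨1, by simp [OnEdge]⟩

theorem onEdge_revEdge {s : 𝒢.E × Bool} {q : Q} :
    OnEdge f (revEdge s) q ↔ OnEdge f s (f (𝒢.sEdge s) * q) := by
  obtain ⟨e, b⟩ := s
  cases b <;> simp [OnEdge, revEdge, sEdge]

theorem conj_mem_map_edgeRange (s : 𝒢.E × Bool) {y : Q}
    (hy : y ∈ (𝒢.edgeRange (revEdge s)).map f) :
    f (𝒢.sEdge s) * y * (f (𝒢.sEdge s))⁻¹ ∈ (𝒢.edgeRange s).map f := by
  obtain ⟨x, hx, rfl⟩ := hy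
  exact ⟨_, conj_mem_edgeRange s hx, by simp⟩

/-- Two passages through the same translate of an edge in the same direction differ by an element
of the edge group. -/
theorem OnEdge.mem_map {s : 𝒢.E × Bool} {p y : Q} (hp : OnEdge f s p)
    (hy : OnEdge f s (y⁻¹ * p)) : y ∈ (𝒢.edgeRange s).map f := by
  obtain ⟨e, b⟩ := s
  cases b
  · have h := Subgroup.mul_mem _ hp (Subgroup.inv_mem _ hy)
    have h2 := conj_mem_map_edgeRange (f := f) (e, false) h
    simpa [sEdge, mul_assoc] using h2
  · have h := Subgroup.mul_mem _ hp (Subgroup.inv_mem _ hy)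
    simpa [mul_assoc] using h

/-- Two passages through the same translate of an edge in opposite directions differ by an element
of the edge group. -/
theorem OnEdge.mem_map_revEdge {s : 𝒢.E × Bool} {p y : Q} (hp : OnEdge f s p)
    (hy : OnEdge f (revEdge s) ((f (𝒢.sEdge s) * y)⁻¹ * p)) :
    y ∈ (𝒢.edgeRange (revEdge s)).map f := by
  have h1 := hp.mem_map (y := f (𝒢.sEdge s) * y * (f (𝒢.sEdge s))⁻¹)
    (by simpa [mul_assoc] using onEdge_revEdge.1 hy)
  have h2 := conj_mem_map_edgeRange (f := f) (revEdge s)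
    (by rwa [show revEdge (revEdge s) = s by simp [revEdge]])
  simpa [sEdge_revEdge, mul_assoc] using h2

variable (f) in
/-- Nonempty closed reduced words of length at most `n` have their values outside the vertex
group of their base vertex, even after applying `f`. -/
def Separates (n : ℕ) : Prop :=
  ∀ (v : 𝒢.V) (l : List 𝒢.Letter), IsWordPath v l v → IsReducedWord l → l ≠ [] → l.length ≤ n →
    ∀ g : 𝒢.GV v, f (wordVal l) ≠ f (𝒢.vert v g)

variable {z} in
/-- Suppose that a closed reduced word of length at most `n + 1` has its value in the vertex group.
Then the first component of this value is trivial, so the lift of the word passes a second time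
through the edge of its first letter.  If the direction is the same, then the initial segment up to
there has a closed lift; if it is the opposite one, then the segment strictly between has.  Either
segment has length at most `n`, and in the second case it is nonempty because the word is
reduced. -/
theorem Separates.wreathHom (hf : ∀ v, Function.Injective (f.comp (𝒢.vert v))) (hz : z ≠ 1)
    {n : ℕ} (hn : Separates f n) : Separates (wreathHom f z) (n + 1) := by
  intro v l hp hr hl hlen g heq
  cases l with
  | nil => exact hl rfl
  | cons a l =>
  obtain ⟨s, g₀⟩ := a
  -- `f (vert g₀) * p` lies on the edge that is traversed by the first letter.
  obtain ⟨p, hps⟩ := exists_onEdge (f := f) s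
  have h1 : (GraphOfGroups.wreathHom f z (wordVal (⟨s, g₀⟩ :: l))).left
      (f (𝒢.vert _ g₀) * p) s.1 = 1 := by
    rw [heq, wreathHom_vert_left]; rfl
  simp only [wordVal, map_mul, RegularWreathProduct.mul_left, Pi.mul_apply, wreathHom_right,
    wreathHom_vert_left, Pi.one_apply, one_mul, inv_mul_cancel_left, mul_assoc] at h1
  have h2 := (wreathHom_sEdge_left f hz s p s.1).2 ⟨rfl, hps⟩
  have h3 : (GraphOfGroups.wreathHom f z (wordVal l)).left ((f (𝒢.sEdge s))⁻¹ * p) s.1 ≠ 1 :=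
    fun h => h2 (by rwa [h, mul_one] at h1)
  obtain ⟨l₁, ⟨t, k⟩, l₂, rfl, ht, h4⟩ := exists_of_wreathHom_left_ne_one f hz _ _ _ h3
  rw [← mul_assoc, ← mul_inv_rev] at h4
  have hlen' : l₁.length + 1 ≤ n := by
    simp only [List.length_cons, List.length_append] at hlen
    omega
  obtain ⟨hv, hp⟩ := hp
  rw [List.map_append, OrGraph.isPath_append] at hp
  obtain ⟨u, hp₁, rfl, -⟩ := hp
  have ht' : t = s ∨ t = revEdge s := by
    obtain ⟨e, b⟩ := s
    obtain ⟨e', b'⟩ := t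
    obtain rfl : e' = e := ht
    cases b <;> cases b' <;> simp [revEdge]
  obtain rfl | rfl := ht'
  · rw [← map_mul, ← mul_assoc] at h4
    obtain ⟨x, hx, hx'⟩ := hps.mem_map h4
    obtain ⟨y, rfl⟩ := edgeRange_le _ hx
    refine hn (𝒢.src t) (⟨t, g₀⟩ :: l₁) ⟨rfl, hp₁⟩ ?_ (by simp) (by simpa using hlen')
      (g₀ * y * k⁻¹) ?_
    · exact List.IsChain.left_of_append (l₂ := ⟨t, k⟩ :: l₂) hr
    · rw [map_mul, map_mul, map_mul, map_mul, hx']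
      simp [wordVal, mul_assoc]
  · obtain ⟨x, hx, hx'⟩ := hps.mem_map_revEdge h4
    obtain ⟨y, rfl⟩ := edgeRange_le _ hx
    -- An empty segment means that the first two letters cancel.
    by_cases hl₁ : l₁ = []
    · subst hl₁
      rw [wordVal, one_mul] at hx'
      obtain rfl := hf _ hx'
      exact (List.isChain_cons_cons.1 hr).1 rfl hx
    · refine hn (𝒢.src (revEdge s)) l₁ ?_ ?_ hl₁ (by omega) (y * k⁻¹) ?_
      · obtain ⟨e, b⟩ := s
        cases b <;> exact hp₁
      · exact hr.tail.left_of_append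
      · rw [map_mul, map_mul, hx']
        simp

end wreath

variable {C : ExtClosedPseudovariety.{u}} {M Q : Type u} [Group M] [Group Q]

/-- Vertex groups that are separated by a homomorphism to a group in `C` embed in the pro-`C`
fundamental group. -/
theorem isInjective_of_hom (f : 𝒢.PathGroup →* Q)
    (hf : ∀ v, Function.Injective (f.comp (𝒢.vert v))) (hQ : C.Mem Q) : 𝒢.IsInjective C := by
  have key : ∀ (v w : 𝒢.V) (p : 𝒢.PathGroup) (hp : 𝒢.IsWord v w p), Function.Injective
      ((C.toCompletion (𝒢.fundamentalGroupAt v)).comp (𝒢.vertToAt hp)) := by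
    intro v w p hp
    refine (injective_iff_map_eq_one _).2 fun g hg => by_contra fun hne => ?_
    refine C.toCompletion_ne_one (f.comp (Subgroup.subtype _)) hQ ?_ hg
    intro h
    have h1 : f (𝒢.vert w g) = 1 := by simpa [vertToAt] using h
    exact hne (hf w (by simpa using h1))
  exact ⟨key, fun v e p hp => (key v _ p hp).comp (𝒢.b0_injective e)⟩

variable [Finite 𝒢.E]

theorem exists_separates {z : M} (hz : z ≠ 1) (hM : C.Mem M) (f : 𝒢.PathGroup →* Q)
    (hf : ∀ v, Function.Injective (f.comp (𝒢.vert v))) (hQ : C.Mem Q) (n : ℕ) :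
    ∃ (Q' : Type u) (_ : Group Q') (f' : 𝒢.PathGroup →* Q'), C.Mem Q' ∧
      (∀ v, Function.Injective (f'.comp (𝒢.vert v))) ∧ Separates f' n := by
  induction n with
  | zero =>
    exact ⟨Q, _, f, hQ, hf, fun v l _ _ hl hlen =>
      absurd (List.length_eq_zero_iff.1 (Nat.le_zero.1 hlen)) hl⟩
  | succ n ih =>
    obtain ⟨Q', _, f', hQ', hf', hn⟩ := ih
    refine ⟨_, _, wreathHom f' z, C.mem_regularWreathProduct (C.mem_pi hM 𝒢.E) hQ', ?_,
      hn.wreathHom hf' hz⟩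
    intro v x y hxy
    have := congrArg RegularWreathProduct.right hxy
    simp only [MonoidHom.comp_apply, wreathHom_right] at this
    exact hf' v this

/-- A graph of groups with finitely many edges whose vertex groups are separated by a homomorphism
to a group in `C` has residually `C` fundamental group.  If there is no edge, then `C` may be
trivial. -/
theorem residually_fundamentalGroupAt
    (hC : Nonempty 𝒢.E → ∃ (M : Type u) (_ : Group M), Nontrivial M ∧ C.Mem M)
    (f : 𝒢.PathGroup →* Q) (hf : ∀ v, Function.Injective (f.comp (𝒢.vert v))) (hQ : C.Mem Q)
    (v : 𝒢.V) : C.Residually (𝒢.fundamentalGroupAt v) := by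
  refine C.residually_of_forall_hom fun ⟨x, hx⟩ hx1 => ?_
  obtain ⟨l, h, hp, hr, rfl⟩ := IsWord.exists_reduced hx
  rcases eq_or_ne l [] with hl | hl
  · refine ⟨Q, _, f.comp (Subgroup.subtype _), hQ, fun h1 => hx1 (Subtype.ext ?_)⟩
    subst hl
    have h2 : f (𝒢.vert v h) = 1 := by simpa [wordVal] using h1
    obtain rfl : h = 1 := hf v (by simpa using h2)
    simp [wordVal]
  · obtain ⟨M, _, _, hM⟩ := hC ⟨(l.head hl).1.1⟩
    obtain ⟨z, hz⟩ := exists_ne (1 : M)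
    obtain ⟨Q', _, f', hQ', hf', hn⟩ := exists_separates hz hM f hf hQ l.length
    refine ⟨Q', _, f'.comp (Subgroup.subtype _), hQ', fun h1 => ?_⟩
    refine hn v l hp hr hl le_rfl h⁻¹ ?_
    rw [map_inv, map_inv]
    exact eq_inv_of_mul_eq_one_left (by simpa using h1)

end GraphOfGroups

/-! ### Vertex groups embed in the fundamental group -/

/-- Two embeddings `i` and `j` of a group `A` into `H` become conjugate in the group of permutations
of `H × (H × ℕ)`: through either of them this set is a free `A`-set with `|H × ℕ|` orbits, as the
number of cosets of `A` in `H` is absorbed by `|H × ℕ|`. -/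
theorem MonoidHom.exists_equiv_conj {A H : Type u} [Group A] [Group H] (i j : A →* H)
    (hi : Function.Injective i) (hj : Function.Injective j) :
    ∃ σ : Equiv.Perm (H × (H × ℕ)), ∀ (a : A) (x : H × (H × ℕ)),
      σ (j a * x.1, x.2) = (i a * (σ x).1, (σ x).2) := by
  have key : ∀ i : A →* H, Function.Injective i → ∃ τ : H × (H × ℕ) ≃ A × (H × ℕ),
      ∀ (a : A) (x : H × (H × ℕ)), τ (i a * x.1, x.2) = (a * (τ x).1, (τ x).2) := by
    intro i hi
    obtain ⟨S, hS, h1⟩ := i.range.exists_isComplement_right 1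
    have hcard : Nonempty (S × (H × ℕ) ≃ H × ℕ) := by
      rw [← Cardinal.eq, Cardinal.mk_prod, Cardinal.lift_id, Cardinal.lift_id]
      refine Cardinal.mul_eq_right (Cardinal.aleph0_le_mk _) ?_ ?_
      · exact (Cardinal.mk_set_le S).trans
          (Cardinal.mk_le_of_injective (f := fun h : H => (h, 0)) fun _ _ h => congrArg Prod.fst h)
      · exact Cardinal.mk_ne_zero_iff.2 ⟨⟨1, h1⟩⟩
    obtain ⟨ρ⟩ := hcard
    refine ⟨(Equiv.prodCongr (hS.equiv.trans (Equiv.prodCongr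
      (MonoidHom.ofInjective hi).symm.toEquiv (Equiv.refl _))) (Equiv.refl _)).trans
      ((Equiv.prodAssoc _ _ _).trans (Equiv.prodCongr (Equiv.refl _) ρ)), fun a x => ?_⟩
    have h2 := hS.equiv_mul_left (MonoidHom.ofInjective hi a) x.1
    rw [MonoidHom.ofInjective_apply] at h2
    refine Prod.ext ?_ ?_
    · change (MonoidHom.ofInjective hi).symm (hS.equiv (i a * x.1)).1 =
        a * (MonoidHom.ofInjective hi).symm (hS.equiv x.1).1
      rw [h2, map_mul, MulEquiv.symm_apply_apply]
    · change ρ ((hS.equiv (i a * x.1)).2, x.2) = ρ ((hS.equiv x.1).2, x.2)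
      rw [h2]
  obtain ⟨τ, hτ⟩ := key i hi
  obtain ⟨τ', hτ'⟩ := key j hj
  refine ⟨τ'.trans τ.symm, fun a x => ?_⟩
  rw [Equiv.trans_apply, Equiv.symm_apply_eq, hτ, hτ']
  simp

namespace GraphOfGroups

variable (𝒢 : GraphOfGroups.{u})

/-- The product of all vertex groups acts on a set where the two embeddings of every edge group are
conjugate. -/
theorem vert_injective (v : 𝒢.V) : Function.Injective (𝒢.vert v) := by
  classical
  let H := ∀ v, 𝒢.GV v
  let act : H →* Equiv.Perm (H × (H × ℕ)) :=
    { toFun h := Equiv.prodCongr (Equiv.mulLeft h) (Equiv.refl _)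
      map_one' := by ext x <;> simp
      map_mul' a b := by ext x <;> simp [mul_assoc] }
  have hemb : ∀ v, Function.Injective (MonoidHom.mulSingle 𝒢.GV v) :=
    fun v => Pi.mulSingle_injective v
  choose t ht using fun e => MonoidHom.exists_equiv_conj
    ((MonoidHom.mulSingle 𝒢.GV _).comp (𝒢.b0 e)) ((MonoidHom.mulSingle 𝒢.GV _).comp (𝒢.b1 e))
    ((hemb _).comp (𝒢.b0_injective e)) ((hemb _).comp (𝒢.b1_injective e))
  let F := 𝒢.pathLift (fun v => act.comp (MonoidHom.mulSingle 𝒢.GV v)) t <| by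
    intro e x
    rw [eq_mul_inv_iff_mul_eq]
    exact Equiv.ext fun y => (ht e x y).symm
  intro g g' h
  have h1 : F (𝒢.vert v g) (1, (1, 0)) = F (𝒢.vert v g') (1, (1, 0)) := by rw [h]
  simp only [F, pathLift_vert] at h1
  have h2 := congrArg Prod.fst h1
  simp only [act, MonoidHom.comp_apply, MonoidHom.coe_mk, OneHom.coe_mk, Equiv.prodCongr_apply,
    Prod.map_fst, Equiv.coe_mulLeft, mul_one] at h2
  exact hemb v h2

variable {𝒢} {T : Set 𝒢.E}

/-- Free reduction keeps a closed path in `T` closed and in `T`, and `T` has no nonempty reduced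
closed path. -/
theorem freeGroup_mk_eq_one_of_isPath (hT : 𝒢.IsMaximalSubtree T) {v : 𝒢.V}
    {l : List (𝒢.E × Bool)} (hl : ∀ s ∈ l, s.1 ∈ T) (hp : 𝒢.IsPath v l v) :
    FreeGroup.mk l = 1 := by
  classical
  have key : ∀ l l', FreeGroup.Red l l' → (∀ s ∈ l, s.1 ∈ T) → 𝒢.IsPath v l v →
      (∀ s ∈ l', s.1 ∈ T) ∧ 𝒢.IsPath v l' v := by
    intro l l' h
    induction h with
    | refl => exact fun h1 h2 => ⟨h1, h2⟩
    | tail _ hs ih =>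
      intro h1 h2
      obtain ⟨h1, h2⟩ := ih h1 h2
      cases hs with
      | @not l₁ l₂ e b =>
        refine ⟨fun s hs => h1 s ?_, ?_⟩
        · simp only [List.mem_append, List.mem_cons] at hs ⊢
          tauto
        · rw [OrGraph.isPath_append] at h2 ⊢
          obtain ⟨u, h3, rfl, h4, h5⟩ := h2
          refine ⟨_, h3, ?_⟩
          cases b <;> exact h5
  obtain ⟨h1, h2⟩ := key l _ FreeGroup.reduce.red hl hp
  have h3 : FreeGroup.reduce l = [] := hT.2 v _ h1 (by
    rw [← FreeGroup.toWord_mk]; exact FreeGroup.isReduced_toWord) h2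
  rw [← FreeGroup.toWord_eq_nil_iff, FreeGroup.toWord_mk, h3]

/-- Conjugating each vertex group by the word of a path in `T` from a base vertex gives a
homomorphism from the fundamental group with respect to `T` back to the path group. -/
theorem vertHom_injective (hT : 𝒢.IsMaximalSubtree T) (v : 𝒢.V) :
    Function.Injective (𝒢.vertHom T v) := by
  choose l hl hp using hT.1 v
  let ι : FreeGroup 𝒢.E →* 𝒢.PathGroup := FreeGroup.lift 𝒢.edge
  let p : 𝒢.V → 𝒢.PathGroup := fun w => ι (FreeGroup.mk (l w))
  have htree : ∀ e ∈ T, p (𝒢.d0 e) * 𝒢.edge e * (p (𝒢.d1 e))⁻¹ = 1 := by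
    intro e he
    have h1 : FreeGroup.mk (l (𝒢.d0 e) ++ (e, true) :: FreeGroup.invRev (l (𝒢.d1 e))) = 1 := by
      refine freeGroup_mk_eq_one_of_isPath hT (v := v) ?_ ?_
      · intro s hs
        simp only [List.mem_append, List.mem_cons, FreeGroup.invRev, List.mem_reverse,
          List.mem_map] at hs
        obtain hs | rfl | ⟨s', hs, rfl⟩ := hs
        exacts [hl _ s hs, he, hl _ s' hs]
      · exact OrGraph.isPath_append.2 ⟨_, hp _, rfl, OrGraph.isPath_invRev (hp _)⟩
    have h2 := congrArg ι h1
    rw [← List.singleton_append, ← FreeGroup.mul_mk, ← FreeGroup.mul_mk, ← FreeGroup.inv_mk,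
      map_mul, map_mul, map_inv, map_one, ← mul_assoc] at h2
    simpa [p, ι] using h2
  let F := 𝒢.pathLift (fun w => (MulAut.conj (p w)).toMonoidHom.comp (𝒢.vert w))
    (fun e => p (𝒢.d0 e) * 𝒢.edge e * (p (𝒢.d1 e))⁻¹) <| by
      intro e x
      simp [vert_b0, mul_assoc]
  let F' : 𝒢.FundamentalGroup T →* 𝒢.PathGroup := QuotientGroup.lift _ F <| by
    refine Subgroup.normalClosure_le_normal (N := F.ker) ?_
    rintro _ ⟨e, he, rfl⟩
    simpa [F] using htree e he
  intro g g' h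
  have h1 : F (𝒢.vert v g) = F (𝒢.vert v g') := congrArg F' h
  simp only [F, pathLift_vert] at h1
  exact 𝒢.vert_injective v ((MulAut.conj (p v)).injective h1)

/-! ### Nontriviality of the fundamental group -/

theorem stable_ne_one (e : 𝒢.E) (he : e ∉ T) : 𝒢.stable T e ≠ 1 := by
  classical
  let F : 𝒢.PathGroup →* Multiplicative ℤ := 𝒢.pathLift (fun _ => 1)
    (fun e' => if e' = e then Multiplicative.ofAdd 1 else 1) (by simp)
  let F' : 𝒢.FundamentalGroup T →* Multiplicative ℤ := QuotientGroup.lift _ F <| by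
    refine Subgroup.normalClosure_le_normal (N := F.ker) ?_
    rintro _ ⟨e', he', rfl⟩
    have : e' ≠ e := fun h => he (h ▸ he')
    simp [F, this]
  intro h
  have h1 : F (𝒢.edge e) = 1 := (congrArg F' h).trans (map_one F')
  simp [F] at h1

theorem nontrivial_fundamentalGroup (hr : 𝒢.IsReduced) (hT : 𝒢.IsMaximalSubtree T) (e : 𝒢.E) :
    Nontrivial (𝒢.FundamentalGroup T) := by
  by_cases he : 𝒢.d0 e = 𝒢.d1 e
  · refine ⟨_, 1, stable_ne_one e fun heT => ?_⟩
    have := hT.2 (𝒢.d0 e) [(e, true)] (by simpa using heT) FreeGroup.IsReduced.singleton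
      ⟨rfl, he.symm⟩
    simp at this
  · have h1 := (hr e he).1
    rw [Ne, Subgroup.eq_top_iff', not_forall] at h1
    obtain ⟨g, hg⟩ := h1
    refine ⟨𝒢.vertHom T _ g, 𝒢.vertHom T _ 1, (vertHom_injective hT _).ne ?_⟩
    rintro rfl
    exact hg (Subgroup.one_mem _)

/-! ### The finite quotient graph of groups -/

variable {U : Subgroup (𝒢.FundamentalGroup T)} [U.Normal] (r : 𝒢.EdgeRel U)

/-- The natural homomorphism from the path group of `(𝒢_U, Γ_U)` to `G/U`. -/
noncomputable def EdgeRel.toQuotient : r.quot.PathGroup →* 𝒢.FundamentalGroup T ⧸ U :=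
  r.quot.pathLift (fun v => (𝒢.quotVertGroup U v).subtype) r.quotStable <| by
    intro e x
    change (x.1 : 𝒢.FundamentalGroup T ⧸ U) =
      r.quotStable e * ((r.quotStable e)⁻¹ * x.1 * r.quotStable e) * (r.quotStable e)⁻¹
    group

theorem EdgeRel.toQuotient_vert_injective (v : r.quot.V) :
    Function.Injective (r.toQuotient.comp (r.quot.vert v)) := by
  intro x y h
  simp only [MonoidHom.comp_apply, EdgeRel.toQuotient] at h
  exact Subtype.ext h

end GraphOfGroups

theorem mainTheorem8 (C : ExtClosedPseudovariety.{u}) (𝒢 : GraphOfGroups.{u})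
    (h_reduced : 𝒢.IsReduced) (T : Set 𝒢.E) (hT : 𝒢.IsMaximalSubtree T)
    (h_res : C.Residually (𝒢.FundamentalGroup T))
    (Φ : Subgroup (𝒢.FundamentalGroup T)) [Φ.Normal] (hΦ_free : IsFreeGroup Φ)
    (hΦ_open : C.IsOpenSubgroup Φ) (hΦ_mem : C.Mem (𝒢.FundamentalGroup T ⧸ Φ))
    (U : Subgroup (𝒢.FundamentalGroup T)) [U.Normal] (hU_open : C.IsOpenSubgroup U)
    (hUΦ : U ≤ Φ) (r : 𝒢.EdgeRel U) :
    (∀ v : 𝒢.V, C.Residually (r.quot.fundamentalGroupAt (r.quotVertex v))) ∧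
      r.quot.IsInjective C := by
  have hQ := hU_open.mem_quotient
  have : Finite r.quot.E := r.finite_classes
  refine ⟨fun v => r.quot.residually_fundamentalGroupAt ?_ r.toQuotient
    r.toQuotient_vert_injective hQ _,
    r.quot.isInjective_of_hom r.toQuotient r.toQuotient_vert_injective hQ⟩
  -- If `C` is trivial, then so is `G`, and a reduced graph of groups with trivial `G` has no edges.
  rintro ⟨q⟩
  have := GraphOfGroups.nontrivial_fundamentalGroup h_reduced hT (Quotient.out q)
  exact C.exists_nontrivial_mem_of_residually h_res
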